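/- Let $\mathcal{E}$ and $\mathcal{A}$ be finite nonempty sets (states and actions), and let $\mathcal{P}(\mathcal{E})$, $\mathcal{P}(\mathcal{A})$ be the simplices of probability measures on them. A synchronous (discrete-time) mean field game with discounted cost consists of transition probabilities $P_{ija}(\mathbf{m})\ge 0$ with $\sum_{j\in\mathcal{E}}P_{ija}(\mathbf{m})=1$, and costs $c_{i,a}(\mathbf{m})\in\mathbb{R}$, for $i,j\in\mathcal{E}$, $a\in\mathcal{A}$, $\mathbf{m}\in\mathcal{P}(\mathcal{E})$, together with an initial distribution $\mathbf{m}_0\in\mathcal{P}(\mathcal{E})$ and a discount factor $\delta\in(0,1)$. An open-loop (mixed) strategy is a function $\pi:\mathcal{E}\times\mathbb{Z}_{\ge0}\to\mathcal{P}(\mathcal{A})$; we write $\pi_{i,a}(t)$ for the probability it gives to action $a$ in state $i$ at time $t$. If the population plays $\pi$, the population distribution is given by $\mathbf{m}^\pi(0)=\mathbf{m}_0$ and $$m^\pi_j(t+1)=\sum_{i\in\mathcal{E}}\sum_{a\in\mathcal{A}}m^\pi_i(t)\,P_{ija}(\mathbf{m}^\pi(t))\,\pi_{i,a}(t).$$ If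 Player 0 plays $\pi^0$ against this population, her state distribution is given by $\mathbf{x}(0)=\mathbf{m}_0$ and $$x_j(t+1)=\sum_{i\in\mathcal{E}}\sum_{a\in\mathcal{A}}x_i(t)\,P_{ija}(\mathbf{m}^\pi(t))\,\pi^0_{i,a}(t),$$ and her cost is $$V(\pi^0,\pi)=(1-\delta)\sum_{t=0}^\infty\delta^t\sum_{i\in\mathcal{E}}\sum_{a\in\mathcal{A}}x_i(t)\,c_{i,a}(\mathbf{m}^\pi(t))\,\pi^0_{i,a}(t).$$ **Theorem.** Assume (A1): every map $\mathbf{m}\mapsto P_{ija}(\mathbf{m})$ is Lipschitz-continuous and every map $\mathbf{m}\mapsto c_{i,a}(\mathbf{m})$ is continuous on $\mathcal{P}(\mathcal{E})$. Then the game has a mean field equilibrium in open-loop strategies, that is, an open-loop strategy $\pi$ that is a best response to itself: $V(\pi,\pi)\le V(\pi^0,\pi)$ for every open-loop strategy $\pi^0$. -/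

import Mathlib

open scoped NNReal

/-- A synchronous (discrete-time) mean field game with discounted cost, with finite state set `E`
and finite action set `A`. The set `𝒫(E)` of population distributions is `stdSimplex ℝ E`. -/
structure SynchronousMFG (E A : Type*) [Fintype E] [Fintype A] where
  /-- `P i j a m` is the probability that a player in state `i` who plays the action `a` moves to
  the state `j`, when the population distribution is `m`. -/
  P : E → E → A → stdSimplex ℝ E → ℝ
  P_nonneg : ∀ i j a m, 0 ≤ P i j a m
  P_sum : ∀ i a m, ∑ j, P i j a m = 1
  /-- The initial population distribution. -/
  m₀ : stdSimplex ℝ E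
  /-- `c i a m` is the instantaneous cost of playing `a` in state `i`, when the population
  distribution is `m`. -/
  c : E → A → stdSimplex ℝ E → ℝ
  /-- The discount factor. -/
  δ : ℝ
  δ_pos : 0 < δ
  δ_lt_one : δ < 1

namespace SynchronousMFG

variable {E A : Type*} [Fintype E] [Fintype A]

/-- A mixed open-loop strategy: `π i t` is the probability measure on the actions that is used in
state `i` at time `t`. -/
abbrev Strategy (E A : Type*) [Fintype A] : Type _ := E → ℕ → stdSimplex ℝ A

/-- The transition probabilities are Lipschitz-continuous, and the costs continuous, in the
population distribution. -/
def AssumptionA1 (G : SynchronousMFG E A) : Prop :=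
  (∃ L : ℝ≥0, ∀ i j a, LipschitzWith L (G.P i j a)) ∧ ∀ i a, Continuous (G.c i a)

/-- The law at time `t + 1` of a player whose law at time `t` is `x` and who plays the mixed action
`p i` in each state `i`, when the population distribution at time `t` is `m`. -/
def step (G : SynchronousMFG E A) (m x : stdSimplex ℝ E) (p : E → stdSimplex ℝ A) :
    stdSimplex ℝ E :=
  ⟨fun j => ∑ i, ∑ a, x.1 i * G.P i j a m * (p i).1 a,
    fun j => Finset.sum_nonneg fun i _ => Finset.sum_nonneg fun a _ =>
      mul_nonneg (mul_nonneg (x.2.1 i) (G.P_nonneg i j a m)) ((p i).2.1 a), by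
    calc ∑ j, ∑ i, ∑ a, x.1 i * G.P i j a m * (p i).1 a
        = ∑ i, ∑ a, ∑ j, x.1 i * G.P i j a m * (p i).1 a := by
          rw [Finset.sum_comm]
          exact Finset.sum_congr rfl fun i _ => Finset.sum_comm
      _ = ∑ i, ∑ a, x.1 i * (p i).1 a := by
          refine Finset.sum_congr rfl fun i _ => Finset.sum_congr rfl fun a _ => ?_
          rw [← Finset.sum_mul, ← Finset.mul_sum, G.P_sum, mul_one]
      _ = ∑ i, x.1 i := by
          refine Finset.sum_congr rfl fun i _ => ?_
          rw [← Finset.mul_sum, (p i).2.2, mul_one]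
      _ = 1 := x.2.2⟩

/-- The population distribution `m^π(t)` when the population plays `π`. -/
def popDist (G : SynchronousMFG E A) (π : Strategy E A) : ℕ → stdSimplex ℝ E
  | 0 => G.m₀
  | t + 1 => G.step (G.popDist π t) (G.popDist π t) fun i => π i t

/-- The state distribution `x(t)` of Player 0, who plays `π₀` against a population that plays `π`;
as every player, she starts from the law `m₀`. -/
def playerDist (G : SynchronousMFG E A) (π₀ π : Strategy E A) : ℕ → stdSimplex ℝ E
  | 0 => G.m₀
  | t + 1 => G.step (G.popDist π t) (G.playerDist π₀ π t) fun i => π₀ i t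

/-- The expected cost of Player 0 at time `t`, before discounting. -/
def stageCost (G : SynchronousMFG E A) (π₀ π : Strategy E A) (t : ℕ) : ℝ :=
  ∑ i, ∑ a, (G.playerDist π₀ π t).1 i * G.c i a (G.popDist π t) * (π₀ i t).1 a

/-- The discounted cost `V(π₀, π)` of Player 0, who plays `π₀` against a population that plays `π`;
the series converges under `AssumptionA1`, see `summable_cost`. -/
noncomputable def V (G : SynchronousMFG E A) (π₀ π : Strategy E A) : ℝ :=
  (1 - G.δ) * ∑' t : ℕ, G.δ ^ t * G.stageCost π₀ π t

/-- The series that defines the discounted cost converges. -/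
theorem summable_cost (G : SynchronousMFG E A) (hG : G.AssumptionA1) (π₀ π : Strategy E A) :
    Summable fun t : ℕ => G.δ ^ t * G.stageCost π₀ π t := by
  have hb : ∀ i a, ∃ C : ℝ, ∀ m, |G.c i a m| ≤ C := fun i a => by
    haveI : CompactSpace (stdSimplex ℝ E) := isCompact_iff_compactSpace.mp (isCompact_stdSimplex ℝ E)
    obtain ⟨C, hC⟩ := isCompact_univ.exists_bound_of_continuousOn (hG.2 i a).continuousOn
    exact ⟨C, fun m => hC m (Set.mem_univ m)⟩
  choose C hC using hb
  refine Summable.of_norm_bounded (g := fun t : ℕ => G.δ ^ t * ∑ i, ∑ a, C i a)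
    ((summable_geometric_of_lt_one G.δ_pos.le G.δ_lt_one).mul_right _) fun t => ?_
  rw [Real.norm_eq_abs, abs_mul, abs_of_nonneg (pow_nonneg G.δ_pos.le t)]
  refine mul_le_mul_of_nonneg_left ?_ (pow_nonneg G.δ_pos.le t)
  refine (Finset.abs_sum_le_sum_abs _ _).trans (Finset.sum_le_sum fun i _ => ?_)
  refine (Finset.abs_sum_le_sum_abs _ _).trans (Finset.sum_le_sum fun a _ => ?_)
  have hx := mem_Icc_of_mem_stdSimplex (G.playerDist π₀ π t).2 i
  have hp := mem_Icc_of_mem_stdSimplex (π₀ i t).2 a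
  have hc := hC i a (G.popDist π t)
  rw [abs_mul, abs_mul, abs_of_nonneg hx.1, abs_of_nonneg hp.1]
  have h0 := abs_nonneg (G.c i a (G.popDist π t))
  exact (mul_le_of_le_one_right (mul_nonneg hx.1 h0) hp.2).trans
    ((mul_le_of_le_one_left h0 hx.2).trans hc)

/-- The set of best responses of Player 0 to the population strategy `π`. -/
def BR (G : SynchronousMFG E A) (π : Strategy E A) : Set (Strategy E A) :=
  {π₀ | ∀ σ : Strategy E A, G.V π₀ π ≤ G.V σ π}

/-- A mean field equilibrium (in open-loop strategies): a best response to itself. -/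
def IsMeanFieldEquilibrium (G : SynchronousMFG E A) (π : Strategy E A) : Prop :=
  π ∈ G.BR π

end SynchronousMFG

/-!
The game truncated at a horizon `T` has an equilibrium by a fixed-point argument, and a limit of
such equilibria is an equilibrium of the discounted game.

*Finite horizon.* Fix the population strategy `π`, hence the flow `G.popDist π`. Backward induction
defines the least cost `minCost` over the remaining stages and the cost `actionCost` of each action
when play is optimal afterwards; both depend continuously on `π`. Minimal costs bound the cost of
every strategy from below (`sum_mul_minCost_le_horizonCost`), and the bound is attained by a
strategy that only uses actions of minimal `actionCost` (`horizonCost_le_sum_mul_minCost`). So it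
suffices to find `π` supported, in each state and at each time before `T`, on actions of minimal
`actionCost` relative to `π` itself. A fixed point of Nash's improvement map, on the finite product
of simplices over the states and the times before `T`, has this property
(`exists_forall_sum_mul_le`).

*Limit.* The space of strategies is compact and metrizable, and the truncated costs converge to the
discounted cost uniformly in both strategies, because the discount factor is less than one
(`tendstoUniformly_horizonCost`). The inequality between truncated costs therefore passes to the
limit along a convergent subsequence of truncated equilibria.

*Brouwer's theorem* is proved by the method of Milnor and Rogers. Suppose that `g` is `C¹` near the
closed unit ball, vanishes on the sphere, and that `x + g x` stays in the ball. For small `t` the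
map `x ↦ x + t • g x` permutes the open ball, so that the integral of its Jacobian is the volume
of the ball. This integral is a polynomial in `t`, so the same holds for `t = 1`
(`setIntegral_det_id_add_fderiv`). If `x ↦ x + g x` were a retraction onto the sphere, its Jacobian
would vanish, a contradiction. A fixed-point-free `C¹` self-map of the ball would yield such a
retraction, and continuous maps are handled by smooth approximation
(`Continuous.exists_isFixedPt_of_bounded`).
-/

open Metric Set MeasureTheory

/-! ### Determinants of perturbations of the identity -/

theorem ContinuousLinearMap.exists_polynomial_det_id_add_smul {F : Type*} [NormedAddCommGroup F]
    [NormedSpace ℝ F] [FiniteDimensional ℝ F] (L : F →L[ℝ] F) :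
    ∃ p : Polynomial ℝ, p.natDegree ≤ Module.finrank ℝ F ∧
      ∀ t : ℝ, (ContinuousLinearMap.id ℝ F + t • L).det = p.eval t := by
  classical
  let b := Module.finBasis ℝ F
  let M := LinearMap.toMatrix b b (L : F →ₗ[ℝ] F)
  refine ⟨Matrix.det ((Polynomial.X : Polynomial ℝ) • M.map Polynomial.C +
    (1 : Matrix _ _ ℝ).map Polynomial.C), ?_, fun t => ?_⟩
  · simpa using Polynomial.natDegree_det_X_add_C_le M 1
  · rw [ContinuousLinearMap.det, ← LinearMap.det_toMatrix b, ← Polynomial.coe_evalRingHom,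
      RingHom.map_det]
    congr 1
    ext i j
    simp [M, LinearMap.toMatrix_apply, Matrix.one_apply, Finsupp.single_apply, eq_comm, add_comm]
    split_ifs <;> simp [mul_comm]

/-- Lagrange interpolation of the polynomial `t ↦ det (1 + t L)`: its value at `1` is a combination,
with coefficients independent of `L`, of its values at any `finrank + 1` nodes. -/
theorem ContinuousLinearMap.det_id_add_eq_sum_basis {F : Type*} [NormedAddCommGroup F]
    [NormedSpace ℝ F] [FiniteDimensional ℝ F] (L : F →L[ℝ] F) {s : Finset ℕ} {v : ℕ → ℝ}
    (hv : Set.InjOn v s) (hs : Module.finrank ℝ F < s.card) :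
    (ContinuousLinearMap.id ℝ F + L).det =
      ∑ k ∈ s, (Lagrange.basis s v k).eval 1 * (ContinuousLinearMap.id ℝ F + v k • L).det := by
  obtain ⟨p, hp, hpL⟩ := L.exists_polynomial_det_id_add_smul
  have hdeg : p.degree < s.card :=
    Polynomial.degree_le_natDegree.trans_lt (by exact_mod_cast hp.trans_lt hs)
  have h1 := hpL 1
  rw [one_smul] at h1
  rw [h1]
  conv_lhs => rw [Lagrange.eq_interpolate hv hdeg]
  simp [Lagrange.interpolate_apply, Polynomial.eval_finsetSum, hpL, mul_comm]

theorem ContinuousLinearMap.det_ne_zero_of_injective {F : Type*} [NormedAddCommGroup F]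
    [NormedSpace ℝ F] [FiniteDimensional ℝ F] {L : F →L[ℝ] F} (h : Function.Injective L) :
    L.det ≠ 0 := by
  have : LinearMap.ker (L : F →ₗ[ℝ] F) = ⊥ := LinearMap.ker_eq_bot.2 h
  intro h0
  exact (LinearMap.bot_lt_ker_of_det_eq_zero (f := (L : F →ₗ[ℝ] F)) h0).ne' this

theorem ContinuousLinearMap.det_id_add_pos {F : Type*} [NormedAddCommGroup F]
    [NormedSpace ℝ F] [FiniteDimensional ℝ F] {L : F →L[ℝ] F} (hL : ‖L‖ < 1) :
    0 < (ContinuousLinearMap.id ℝ F + L).det := by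
  obtain ⟨p, -, hp⟩ := L.exists_polynomial_det_id_add_smul
  have hne : ∀ s ∈ Icc (0 : ℝ) 1, p.eval s ≠ 0 := by
    intro s hs
    rw [← hp]
    apply det_ne_zero_of_injective
    refine (injective_iff_map_eq_zero _).2 fun x hx => ?_
    have hx' : x = -(s • L x) := eq_neg_of_add_eq_zero_left (by simpa using hx)
    by_contra hx0
    have h1 : ‖x‖ ≤ ‖L‖ * ‖x‖ := by
      calc ‖x‖ = ‖s • L x‖ := by conv_lhs => rw [hx', norm_neg]
        _ = s * ‖L x‖ := by rw [norm_smul, Real.norm_of_nonneg hs.1]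
        _ ≤ 1 * ‖L x‖ := by gcongr; exact hs.2
        _ ≤ ‖L‖ * ‖x‖ := by rw [one_mul]; exact L.le_opNorm x
    nlinarith [norm_pos_iff.2 hx0]
  have h0 : p.eval 0 = 1 := by rw [← hp]; simp [ContinuousLinearMap.det]
  have h1 := hp 1
  rw [one_smul] at h1
  rw [h1]
  by_contra hle
  push Not at hle
  obtain ⟨s, hs, hs0⟩ := intermediate_value_Icc' (zero_le_one) p.continuous.continuousOn
    (show (0 : ℝ) ∈ Icc (p.eval 1) (p.eval 0) from ⟨hle, by rw [h0]; exact zero_le_one⟩)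
  exact hne s hs hs0

/-! ### Lipschitz perturbations of the identity -/

/-- Extending by zero outside the unit ball does not increase the Lipschitz constant of a map that
vanishes on the unit sphere. -/
theorem LipschitzOnWith.indicator_closedBall {F : Type*} [NormedAddCommGroup F]
    [NormedSpace ℝ F] {g : F → F} {K : ℝ≥0} (hg : LipschitzOnWith K g (closedBall 0 1))
    (h0 : ∀ x, ‖x‖ = 1 → g x = 0) :
    LipschitzWith K ((closedBall (0 : F) 1).indicator g) := by
  have key : ∀ x ∈ closedBall (0 : F) 1, ∀ y ∉ closedBall (0 : F) 1, ‖g x‖ ≤ K * ‖x - y‖ := by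
    intro x hx y hy
    simp only [mem_closedBall, dist_zero_right, not_le] at hx hy
    obtain ⟨s, hs, hsx⟩ := intermediate_value_Icc (zero_le_one (α := ℝ))
      (f := fun s : ℝ => ‖x + s • (y - x)‖) (by fun_prop)
      (show (1 : ℝ) ∈ Icc _ _ from ⟨by simpa using hx, by simpa using hy.le⟩)
    have h := hg.norm_sub_le (x := x) (by simpa using hx) (y := x + s • (y - x))
      (by simp only [mem_closedBall, dist_zero_right]; exact hsx.le)
    rw [h0 _ hsx, sub_zero, sub_add_cancel_left, norm_neg, norm_smul, Real.norm_of_nonneg hs.1,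
      norm_sub_rev] at h
    refine h.trans ?_
    gcongr
    exact mul_le_of_le_one_left (norm_nonneg _) hs.2
  refine LipschitzWith.of_dist_le_mul fun x y => ?_
  rw [dist_eq_norm, dist_eq_norm]
  by_cases hx : x ∈ closedBall (0 : F) 1 <;> by_cases hy : y ∈ closedBall (0 : F) 1
  · simpa [hx, hy] using hg.norm_sub_le hx hy
  · rw [indicator_of_mem hx, indicator_of_notMem hy, sub_zero]
    exact key x hx y hy
  · rw [indicator_of_mem hy, indicator_of_notMem hx, zero_sub, norm_neg, norm_sub_rev]
    exact key y hy x hx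
  · rw [indicator_of_notMem hx, indicator_of_notMem hy, sub_zero, norm_zero]
    positivity

theorem LipschitzWith.injective_id_add_smul {F : Type*} [NormedAddCommGroup F]
    [NormedSpace ℝ F] {G : F → F} {K : ℝ≥0} (hG : LipschitzWith K G) {t : ℝ} (ht : 0 ≤ t)
    (htK : t * K < 1) : Function.Injective fun x => x + t • G x := by
  intro x y hxy
  have h1 : x - y = t • (G y - G x) := by
    have : x + t • G x = y + t • G y := hxy
    rw [smul_sub, sub_eq_sub_iff_add_eq_add, this, add_comm]
  by_contra hne
  have h2 : ‖x - y‖ ≤ t * K * ‖x - y‖ := by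
    calc ‖x - y‖ = t * ‖G y - G x‖ := by
          conv_lhs => rw [h1, norm_smul, Real.norm_of_nonneg ht]
      _ ≤ t * (K * ‖y - x‖) := by gcongr; exact hG.norm_sub_le y x
      _ = t * K * ‖x - y‖ := by rw [norm_sub_rev, mul_assoc]
  nlinarith [norm_pos_iff.2 (sub_ne_zero.2 hne)]

theorem LipschitzWith.surjective_id_add_smul {F : Type*} [NormedAddCommGroup F]
    [NormedSpace ℝ F] [CompleteSpace F] {G : F → F} {K : ℝ≥0} (hG : LipschitzWith K G) {t : ℝ}
    (ht : 0 ≤ t) (htK : t * K < 1) : Function.Surjective fun x => x + t • G x := by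
  intro y
  have hc : ContractingWith (t.toNNReal * K) fun x => y - t • G x := by
    refine ⟨?_, LipschitzWith.of_dist_le_mul fun a b => ?_⟩
    · rw [← NNReal.coe_lt_coe]; simpa [ht] using htK
    · rw [dist_sub_left, dist_smul₀, Real.norm_of_nonneg ht, NNReal.coe_mul,
        Real.coe_toNNReal _ ht, mul_assoc]
      gcongr
      exact hG.dist_le_mul a b
  refine ⟨hc.fixedPoint, ?_⟩
  have := hc.fixedPoint_isFixedPt
  rw [Function.IsFixedPt] at this
  exact eq_sub_iff_add_eq.1 this.symm

/-! ### Brouwer's fixed-point theorem -/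

section Brouwer

variable {F : Type*} [NormedAddCommGroup F] [InnerProductSpace ℝ F] [FiniteDimensional ℝ F]

/-- For small `t` the map `x ↦ x + t • g x` permutes the unit ball, when `g` is Lipschitz and
vanishes on the unit sphere and `x + g x` stays in the ball. -/
theorem image_id_add_smul_ball {g : F → F} {K : ℝ≥0}
    (hg : LipschitzOnWith K g (closedBall 0 1)) (h0 : ∀ x, ‖x‖ = 1 → g x = 0)
    (h1 : ∀ x, ‖x‖ ≤ 1 → ‖x + g x‖ ≤ 1) {t : ℝ} (ht : 0 ≤ t) (ht1 : t < 1) (htK : t * K < 1) :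
    InjOn (fun x => x + t • g x) (ball 0 1) ∧ (fun x => x + t • g x) '' ball 0 1 = ball 0 1 := by
  have hG := hg.indicator_closedBall h0
  have heq : EqOn (fun x => x + t • (closedBall (0 : F) 1).indicator g x) (fun x => x + t • g x)
      (ball 0 1) := fun x hx => by
    simp only [indicator_of_mem (ball_subset_closedBall hx)]
  have hinj := hG.injective_id_add_smul ht htK
  refine ⟨(hinj.injOn).congr heq, Subset.antisymm ?_ ?_⟩
  · rintro _ ⟨x, hx, rfl⟩
    rw [mem_ball_zero_iff] at hx ⊢
    calc ‖x + t • g x‖ = ‖(1 - t) • x + t • (x + g x)‖ := by congr 1; module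
      _ ≤ (1 - t) * ‖x‖ + t * ‖x + g x‖ := by
        refine (norm_add_le _ _).trans_eq ?_
        rw [norm_smul, norm_smul, Real.norm_of_nonneg ht, Real.norm_of_nonneg (by linarith)]
      _ ≤ (1 - t) * ‖x‖ + t * 1 := by gcongr; exact h1 x hx.le
      _ < 1 := by nlinarith
  · intro y hy
    obtain ⟨x, rfl⟩ := hG.surjective_id_add_smul ht htK y
    have hx : x ∈ ball (0 : F) 1 := by
      -- outside the open ball the extended perturbation vanishes, so such an `x` equals its image
      by_contra hx
      have : (closedBall (0 : F) 1).indicator g x = 0 := by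
        by_cases hx' : x ∈ closedBall (0 : F) 1
        · rw [indicator_of_mem hx']
          apply h0
          simp only [mem_ball, mem_closedBall, dist_zero_right, not_lt] at hx hx'
          exact le_antisymm hx' hx
        · exact indicator_of_notMem hx' _
      simp only [this, smul_zero, add_zero] at hy
      exact hx hy
    exact ⟨x, hx, (heq hx).symm⟩

theorem setIntegral_det_id_add_smul_fderiv [MeasurableSpace F] [BorelSpace F] {g : F → F}
    {K : ℝ≥0} {U : Set F} (hU : IsOpen U) (hUB : closedBall 0 1 ⊆ U) (hgU : ContDiffOn ℝ 1 g U)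
    (hg : LipschitzOnWith K g (closedBall 0 1)) (h0 : ∀ x, ‖x‖ = 1 → g x = 0)
    (h1 : ∀ x, ‖x‖ ≤ 1 → ‖x + g x‖ ≤ 1) {t : ℝ} (ht : 0 ≤ t) (ht1 : t < 1) (htK : t * K < 1) :
    ∫ x in ball (0 : F) 1, (ContinuousLinearMap.id ℝ F + t • fderiv ℝ g x).det =
      volume.real (ball (0 : F) 1) := by
  obtain ⟨hinj, himg⟩ := image_id_add_smul_ball hg h0 h1 ht ht1 htK
  have hd : ∀ x ∈ ball (0 : F) 1, HasFDerivWithinAt (fun x => x + t • g x)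
      (ContinuousLinearMap.id ℝ F + t • fderiv ℝ g x) (ball 0 1) x := fun x hx => by
    have hgx : DifferentiableAt ℝ g x := (hgU.differentiableOn one_ne_zero).differentiableAt
      (hU.mem_nhds (hUB (ball_subset_closedBall hx)))
    exact ((hasFDerivAt_id x).add (hgx.hasFDerivAt.const_smul t)).hasFDerivWithinAt
  have hcv := integral_image_eq_integral_abs_det_fderiv_smul volume measurableSet_ball hd hinj
    (fun _ => (1 : ℝ))
  rw [himg] at hcv
  simp only [smul_eq_mul, mul_one, integral_const, MeasurableSet.univ, measureReal_restrict_apply,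
    univ_inter] at hcv
  rw [hcv]
  refine setIntegral_congr_fun measurableSet_ball fun x hx => ?_
  refine (abs_of_pos (ContinuousLinearMap.det_id_add_pos ?_)).symm
  have hK : ‖fderiv ℝ g x‖ ≤ K := norm_fderiv_le_of_lipschitzOn ℝ
    (Filter.mem_of_superset (isOpen_ball.mem_nhds hx) ball_subset_closedBall) hg
  rw [norm_smul, Real.norm_of_nonneg ht]
  exact (mul_le_mul_of_nonneg_left hK ht).trans_lt htK

/-- The integral of the Jacobian of `x ↦ x + t • g x` is a polynomial in `t`. It equals the volume
of the ball for small `t`, hence also for `t = 1`. -/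
theorem setIntegral_det_id_add_fderiv [MeasurableSpace F] [BorelSpace F] {g : F → F}
    {U : Set F} (hU : IsOpen U) (hUB : closedBall 0 1 ⊆ U) (hgU : ContDiffOn ℝ 1 g U)
    (h0 : ∀ x, ‖x‖ = 1 → g x = 0) (h1 : ∀ x, ‖x‖ ≤ 1 → ‖x + g x‖ ≤ 1) :
    ∫ x in ball (0 : F) 1, (ContinuousLinearMap.id ℝ F + fderiv ℝ g x).det =
      volume.real (ball (0 : F) 1) := by
  obtain ⟨K, hK⟩ := (hgU.mono hUB).exists_lipschitzOnWith one_ne_zero (convex_closedBall _ _)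
    (isCompact_closedBall _ _)
  -- the nodes `1 / ((k + 2) (K + 1))` are distinct and small enough for the perturbation
  let v : ℕ → ℝ := fun k => ((k + 2 : ℝ) * (K + 1))⁻¹
  have hv0 : ∀ k, 0 ≤ v k := fun k => by positivity
  have hv1 : ∀ k, v k < 1 := fun k => by
    have : (0 : ℝ) ≤ K := K.2
    refine inv_lt_one_of_one_lt₀ ?_
    nlinarith [(Nat.cast_nonneg k : (0 : ℝ) ≤ k), mul_nonneg (Nat.cast_nonneg (α := ℝ) k) this]
  have hvK : ∀ k, v k * K < 1 := fun k => by
    have : (0 : ℝ) ≤ K := K.2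
    rw [inv_mul_lt_iff₀ (by positivity)]
    nlinarith [(Nat.cast_nonneg k : (0 : ℝ) ≤ k), mul_nonneg (Nat.cast_nonneg (α := ℝ) k) this]
  have hvinj : Function.Injective v := fun k l h => by
    have hne : (K : ℝ) + 1 ≠ 0 := by positivity
    have h2 := mul_right_cancel₀ hne (inv_injective h)
    exact_mod_cast add_right_cancel h2
  let s := Finset.range (Module.finrank ℝ F + 1)
  have hint : ∀ t : ℝ, IntegrableOn
      (fun x => (ContinuousLinearMap.id ℝ F + t • fderiv ℝ g x).det) (ball (0 : F) 1) := fun t => by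
    have hc : ContinuousOn (fderiv ℝ g) (closedBall 0 1) :=
      (hgU.continuousOn_fderiv_of_isOpen hU le_rfl).mono hUB
    have : ContinuousOn (fun x => (ContinuousLinearMap.id ℝ F + t • fderiv ℝ g x).det)
        (closedBall 0 1) :=
      ContinuousLinearMap.continuous_det.comp_continuousOn
        (continuousOn_const.add (hc.const_smul t))
    exact (this.integrableOn_compact (isCompact_closedBall _ _)).mono_set ball_subset_closedBall
  have hsum : ∑ k ∈ s, (Lagrange.basis s v k).eval 1 = 1 := by
    rw [← Polynomial.eval_finsetSum, Lagrange.sum_basis hvinj.injOn (by simp [s]),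
      Polynomial.eval_one]
  calc ∫ x in ball (0 : F) 1, (ContinuousLinearMap.id ℝ F + fderiv ℝ g x).det
      = ∫ x in ball (0 : F) 1, ∑ k ∈ s, (Lagrange.basis s v k).eval 1 *
          (ContinuousLinearMap.id ℝ F + v k • fderiv ℝ g x).det := by
        refine setIntegral_congr_fun measurableSet_ball fun x _ => ?_
        exact ContinuousLinearMap.det_id_add_eq_sum_basis _ hvinj.injOn (by simp [s])
    _ = ∑ k ∈ s, (Lagrange.basis s v k).eval 1 * volume.real (ball (0 : F) 1) := by
        rw [integral_finsetSum _ fun k _ => (hint _).const_mul _]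
        refine Finset.sum_congr rfl fun k _ => ?_
        rw [integral_const_mul,
          setIntegral_det_id_add_smul_fderiv hU hUB hgU hK h0 h1 (hv0 k) (hv1 k) (hvK k)]
    _ = volume.real (ball (0 : F) 1) := by rw [← Finset.sum_mul, hsum, one_mul]

/-- There is no `C¹` retraction of the unit ball onto the unit sphere: the Jacobian of such a
retraction would vanish, but its integral is the volume of the ball. -/
theorem exists_norm_id_add_ne_one {g : F → F} {U : Set F} (hU : IsOpen U)
    (hUB : closedBall 0 1 ⊆ U) (hgU : ContDiffOn ℝ 1 g U) (h0 : ∀ x, ‖x‖ = 1 → g x = 0) :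
    ∃ x, ‖x‖ ≤ 1 ∧ ‖x + g x‖ ≠ 1 := by
  by_contra! h
  borelize F
  have hdet : ∀ x ∈ ball (0 : F) 1, (ContinuousLinearMap.id ℝ F + fderiv ℝ g x).det = 0 := by
    intro x hx
    have hgx : DifferentiableAt ℝ g x := (hgU.differentiableOn one_ne_zero).differentiableAt
      (hU.mem_nhds (hUB (ball_subset_closedBall hx)))
    have hr : HasFDerivAt (fun x => x + g x) (ContinuousLinearMap.id ℝ F + fderiv ℝ g x) x :=
      (hasFDerivAt_id x).add hgx.hasFDerivAt
    have hsq := hr.norm_sq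
    have hcst : HasFDerivAt (fun x => ‖x + g x‖ ^ 2) (0 : F →L[ℝ] ℝ) x := by
      refine (hasFDerivAt_const (1 : ℝ) x).congr_of_eventuallyEq ?_
      filter_upwards [isOpen_ball.mem_nhds hx] with z hz
      rw [h z (mem_closedBall_zero_iff.1 (ball_subset_closedBall hz)), one_pow]
    have hperp := hsq.unique hcst
    by_contra hne
    obtain ⟨w, hw⟩ : ∃ w, (ContinuousLinearMap.id ℝ F + fderiv ℝ g x) w = x + g x := by
      have hu : IsUnit (LinearMap.det
          ((ContinuousLinearMap.id ℝ F + fderiv ℝ g x : F →L[ℝ] F) : F →ₗ[ℝ] F)) :=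
        isUnit_iff_ne_zero.2 hne
      exact ((LinearMap.isUnit_iff_range_eq_top _).1 ((LinearMap.isUnit_iff_isUnit_det _).2 hu)
        |> LinearMap.range_eq_top.1) _
    have h2 := congrArg (fun L : F →L[ℝ] ℝ => L w) hperp
    simp only [smul_apply, ContinuousLinearMap.comp_apply, hw,
      innerSL_apply_apply, zero_apply, real_inner_self_eq_norm_sq,
      h x (mem_closedBall_zero_iff.1 (ball_subset_closedBall hx))] at h2
    norm_num at h2
  have hvol := setIntegral_det_id_add_fderiv hU hUB hgU h0 fun x hx => (h x hx).le
  rw [setIntegral_congr_fun measurableSet_ball hdet, integral_zero] at hvol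
  exact (ENNReal.toReal_pos (measure_ball_pos volume (0 : F) one_pos).ne' measure_ball_lt_top.ne).ne
    hvol

/-- Brouwer's theorem for `C¹` maps. Without a fixed point, sending `x` to the point where the ray
from `f x` through `x` leaves the ball would be a `C¹` retraction onto the sphere. -/
theorem exists_isFixedPt_closedBall_of_contDiff {f : F → F} (hf : ContDiff ℝ 1 f)
    (hfB : ∀ x, ‖x‖ ≤ 1 → ‖f x‖ ≤ 1) : ∃ x, ‖x‖ ≤ 1 ∧ f x = x := by
  by_contra! hfix
  -- `D` is the discriminant of the equation `‖x + l • (x - f x)‖ = 1` for `l`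
  let D : F → ℝ := fun x => inner ℝ x (x - f x) ^ 2 + ‖x - f x‖ ^ 2 * (1 - ‖x‖ ^ 2)
  let l : F → ℝ := fun x => (√(D x) - inner ℝ x (x - f x)) / ‖x - f x‖ ^ 2
  let U : Set F := {x | x - f x ≠ 0} ∩ {x | 0 < D x}
  have hfc := hf.continuous
  have hu : ContDiff ℝ 1 fun x => x - f x := contDiff_id.sub hf
  have hb : ContDiff ℝ 1 fun x => inner ℝ x (x - f x) := contDiff_id.inner ℝ hu
  have hD : ContDiff ℝ 1 D :=
    (hb.pow 2).add ((hu.norm_sq ℝ).mul (contDiff_const.sub (contDiff_id.norm_sq ℝ)))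
  have hU : IsOpen U :=
    (isOpen_ne_fun (by fun_prop) continuous_const).inter (isOpen_lt continuous_const hD.continuous)
  have hne : ∀ x, ‖x‖ ≤ 1 → 0 < ‖x - f x‖ := fun x hx =>
    norm_pos_iff.2 (sub_ne_zero.2 (hfix x hx).symm)
  have hsphere : ∀ x, ‖x‖ = 1 → 0 < inner ℝ x (x - f x) := fun x hx => by
    have h1 := hne x hx.le
    have h2 := norm_sub_sq_real x (f x)
    have h3 := hfB x hx.le
    rw [inner_sub_right, real_inner_self_eq_norm_sq]
    rw [hx] at h2 ⊢
    nlinarith [norm_nonneg (f x), pow_pos h1 2]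
  have hDpos : ∀ x, ‖x‖ ≤ 1 → 0 < D x := fun x hx => by
    have h1 := pow_pos (hne x hx) 2
    rcases hx.lt_or_eq with hx1 | hx1
    · have : 0 < 1 - ‖x‖ ^ 2 := by nlinarith [norm_nonneg x]
      exact add_pos_of_nonneg_of_pos (sq_nonneg _) (mul_pos h1 this)
    · have := pow_pos (hsphere x hx1) 2
      simpa [D, hx1] using this
  have hUB : closedBall 0 1 ⊆ U := fun x hx => by
    rw [mem_closedBall_zero_iff] at hx
    exact ⟨norm_pos_iff.1 (hne x hx), hDpos x hx⟩
  have hgU : ContDiffOn ℝ 1 (fun x => l x • (x - f x)) U := by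
    refine ContDiffOn.smul (ContDiffOn.div ((hD.contDiffOn.sqrt fun x hx => ?_).sub
      hb.contDiffOn) (hu.norm_sq ℝ).contDiffOn fun x hx => ?_) hu.contDiffOn
    · exact hx.2.ne'
    · exact pow_ne_zero 2 (norm_ne_zero_iff.2 hx.1)
  obtain ⟨x, hx, hxne⟩ := exists_norm_id_add_ne_one hU hUB hgU fun x hx => by
    have hDx : D x = inner ℝ x (x - f x) ^ 2 := by simp [D, hx]
    simp only [l, hDx, Real.sqrt_sq (hsphere x hx).le, sub_self, zero_div, zero_smul]
  refine hxne ((sq_eq_sq₀ (norm_nonneg _) zero_le_one).1 ?_)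
  have hN := (pow_pos (hne x hx) 2).ne'
  have hs : √(D x) ^ 2 = inner ℝ x (x - f x) ^ 2 + ‖x - f x‖ ^ 2 * (1 - ‖x‖ ^ 2) :=
    Real.sq_sqrt (hDpos x hx).le
  rw [norm_add_sq_real, real_inner_smul_right, norm_smul, mul_pow, Real.norm_eq_abs, sq_abs]
  simp only [l]
  generalize √(D x) = s at hs ⊢
  generalize ‖x - f x‖ ^ 2 = N at hN hs ⊢
  field_simp
  linear_combination hs

/-- Brouwer's theorem, for a bounded continuous map of the whole space. -/
theorem Continuous.exists_isFixedPt_of_bounded {f : F → F} (hf : Continuous f) {R : ℝ}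
    (hR : ∀ x, ‖f x‖ ≤ R) : ∃ x, f x = x := by
  have hR0 : 0 ≤ R := (norm_nonneg _).trans (hR 0)
  have hr : 0 < 2 * (R + 1) := by positivity
  set r := 2 * (R + 1) with hrdef
  -- the rescaled map sends the unit ball into the ball of radius `1 / 2`
  let h : F → F := fun x => r⁻¹ • f (r • x)
  have hh : Continuous h := by fun_prop
  have hh2 : ∀ x, ‖h x‖ ≤ 1 / 2 := fun x => by
    rw [norm_smul, Real.norm_of_nonneg (inv_nonneg.2 hr.le), inv_mul_le_iff₀ hr]
    linarith [hR (r • x)]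
  suffices ∃ x, h x = x by
    obtain ⟨x, hx⟩ := this
    refine ⟨r • x, ?_⟩
    have hx2 := congrArg (fun y => r • y) hx
    simpa [h, smul_inv_smul₀ hr.ne'] using hx2
  by_contra! hfix
  obtain ⟨x₀, -, hx₀⟩ := (isCompact_closedBall (0 : F) 1).exists_isMinOn
    ⟨0, by simp⟩ (f := fun x => dist x (h x)) (by fun_prop)
  have hδ : 0 < dist x₀ (h x₀) := dist_pos.2 (hfix x₀).symm
  obtain ⟨g, hg, hgd, -⟩ := hh.exists_contDiff_approx 1 (ε := fun _ => min (dist x₀ (h x₀)) (1 / 2))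
    continuous_const fun _ => lt_min hδ (by norm_num)
  obtain ⟨x, hx, hgx⟩ := exists_isFixedPt_closedBall_of_contDiff (f := g) (by exact_mod_cast hg)
    fun x _ => by
      have h1 := (hgd x).le.trans (min_le_right _ _)
      rw [dist_eq_norm] at h1
      linarith [norm_le_norm_add_norm_sub' (g x) (h x), hh2 x]
  have h1 := (hgd x).trans_le (min_le_left _ _)
  rw [hgx] at h1
  exact h1.not_ge (hx₀ (mem_closedBall_zero_iff.2 hx))

end Brouwer

/-! ### Fixed points on products of simplices -/

/-- A continuous retraction of `A → ℝ` onto the simplex: the deficit of the total mass of the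
positive part of `x` is spread evenly, and an excess is removed by rescaling. -/
noncomputable def stdSimplexRetraction {A : Type*} [Fintype A] [Nonempty A] (x : A → ℝ) :
    stdSimplex ℝ A :=
  ⟨fun a => (max (x a) 0 + max (1 - ∑ b, max (x b) 0) 0 / Fintype.card A) /
      max 1 (∑ b, max (x b) 0), fun a => by positivity, by
    have hA : (Fintype.card A : ℝ) ≠ 0 := by simp
    rw [← Finset.sum_div, Finset.sum_add_distrib, Finset.sum_const, Finset.card_univ,
      nsmul_eq_mul, mul_div_cancel₀ _ hA, div_eq_one_iff_eq (by positivity)]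
    rcases le_total 1 (∑ b, max (x b) 0) with h | h
    · rw [max_eq_right h, max_eq_right (by linarith), add_zero]
    · rw [max_eq_left h, max_eq_left (by linarith), add_sub_cancel]⟩

theorem continuous_stdSimplexRetraction {A : Type*} [Fintype A] [Nonempty A] :
    Continuous (stdSimplexRetraction : (A → ℝ) → stdSimplex ℝ A) := by
  refine Continuous.subtype_mk (continuous_pi fun a => Continuous.div (by fun_prop) (by fun_prop)
    fun x => ?_) _
  positivity

theorem stdSimplexRetraction_coe {A : Type*} [Fintype A] [Nonempty A] (p : stdSimplex ℝ A) :
    stdSimplexRetraction p.1 = p := by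
  have h : ∀ a, max (p.1 a) 0 = p.1 a := fun a => max_eq_left (p.2.1 a)
  ext a
  change (max (p.1 a) 0 + max (1 - ∑ b, max (p.1 b) 0) 0 / Fintype.card A) /
      max 1 (∑ b, max (p.1 b) 0) = p.1 a
  simp [h, p.2.2]

/-- Brouwer's theorem for a finite product of simplices. -/
theorem exists_isFixedPt_pi_stdSimplex {ι A : Type*} [Fintype ι] [Fintype A] [Nonempty A]
    {f : (ι → stdSimplex ℝ A) → ι → stdSimplex ℝ A} (hf : Continuous f) : ∃ p, f p = p := by
  let r : EuclideanSpace ℝ (ι × A) → ι → stdSimplex ℝ A :=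
    fun y i => stdSimplexRetraction fun a => y (i, a)
  let e : (ι → stdSimplex ℝ A) → EuclideanSpace ℝ (ι × A) :=
    fun p => WithLp.toLp 2 fun k => (p k.1).1 k.2
  have hr : Continuous r := continuous_pi fun i =>
    continuous_stdSimplexRetraction.comp (by fun_prop)
  have he : Continuous e := by
    refine (PiLp.continuous_toLp 2 _).comp (continuous_pi fun k => ?_)
    exact (continuous_apply k.2).comp (continuous_subtype_val.comp (continuous_apply k.1))
  have hre : ∀ p, r (e p) = p := fun p => funext fun i => stdSimplexRetraction_coe (p i)
  obtain ⟨R, hR⟩ := isCompact_univ.exists_bound_of_continuousOn he.continuousOn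
  obtain ⟨y, hy⟩ := ((he.comp (hf.comp hr))).exists_isFixedPt_of_bounded
    (R := R) fun y => hR (f (r y)) (mem_univ _)
  refine ⟨r y, ?_⟩
  have := congrArg r hy
  simpa [hre] using this

/-! ### Nash's improvement map -/

/-- Nash's improvement map on the simplex: the weight of `a` grows in proportion to the amount by
which its cost `q a` lies below the mean cost. -/
noncomputable def nashMap {A : Type*} [Fintype A] (q : A → ℝ) (p : stdSimplex ℝ A) :
    stdSimplex ℝ A :=
  ⟨fun a => (p.1 a + max (∑ b, p.1 b * q b - q a) 0) /
      (1 + ∑ a, max (∑ b, p.1 b * q b - q a) 0),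
    fun a => div_nonneg (add_nonneg (p.2.1 a) (le_max_right _ _)) (by positivity), by
    rw [← Finset.sum_div, Finset.sum_add_distrib, p.2.2, div_self (by positivity)]⟩

theorem sum_mul_le_of_nashMap_eq {A : Type*} [Fintype A] {q : A → ℝ} {p : stdSimplex ℝ A}
    (h : nashMap q p = p) (b : A) : ∑ a, p.1 a * q a ≤ q b := by
  set m := ∑ b, p.1 b * q b with hm
  set S := ∑ a, max (m - q a) 0 with hS
  have hS0 : 0 ≤ S := Finset.sum_nonneg fun a _ => le_max_right _ _
  have hfix : ∀ a, max (m - q a) 0 = p.1 a * S := fun a => by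
    have h1 : (p.1 a + max (m - q a) 0) / (1 + S) = p.1 a :=
      congrFun (congrArg Subtype.val h) a
    rw [div_eq_iff (by positivity)] at h1
    linarith
  -- some action in the support of `p` costs at least the mean
  obtain ⟨a, ha, hqa⟩ : ∃ a, 0 < p.1 a ∧ m ≤ q a := by
    by_contra! hlt
    have hsum1 : ∑ a, p.1 a * (m - q a) = 0 := by
      simp only [mul_sub, Finset.sum_sub_distrib]
      rw [← Finset.sum_mul, p.2.2, one_mul, hm, sub_self]
    have hnn : ∀ a ∈ Finset.univ, 0 ≤ p.1 a * (m - q a) := fun a _ => by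
      rcases (p.2.1 a).eq_or_lt with h0 | h0
      · rw [← h0, zero_mul]
      · exact mul_nonneg h0.le (sub_nonneg.2 (hlt a h0).le)
    have hz := (Finset.sum_eq_zero_iff_of_nonneg hnn).1 hsum1
    have hp : ∀ a, p.1 a = 0 := fun a => by
      by_contra hne
      have hpos := (p.2.1 a).lt_of_ne' hne
      exact (mul_pos hpos (sub_pos.2 (hlt a hpos))).ne' (hz a (Finset.mem_univ a))
    have h1 := p.2.2
    simp [hp] at h1
  have hS1 : S = 0 := by
    have := hfix a
    rw [max_eq_right (sub_nonpos.2 hqa)] at this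
    exact (mul_eq_zero.1 this.symm).resolve_left ha.ne'
  have := hfix b
  rw [hS1, mul_zero] at this
  linarith [le_max_left (m - q b) 0]

/-- For continuous costs `F`, some `p` is at every index supported on the actions of minimal
cost. -/
theorem exists_forall_sum_mul_le {ι A : Type*} [Fintype ι] [Fintype A] [Nonempty A]
    {F : (ι → stdSimplex ℝ A) → ι → A → ℝ} (hF : Continuous F) :
    ∃ p, ∀ i b, ∑ a, (p i).1 a * F p i a ≤ F p i b := by
  have hp : ∀ i a, Continuous fun p : ι → stdSimplex ℝ A => (p i).1 a := fun i a =>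
    (continuous_apply a).comp (continuous_subtype_val.comp (continuous_apply i))
  have hFc : ∀ i a, Continuous fun p => F p i a := fun i a =>
    (continuous_apply a).comp ((continuous_apply i).comp hF)
  have hgain : ∀ i a, Continuous fun p : ι → stdSimplex ℝ A =>
      max (∑ b, (p i).1 b * F p i b - F p i a) 0 := fun i a =>
    ((continuous_finsetSum _ fun b _ => (hp i b).mul (hFc i b)).sub (hFc i a)).max continuous_const
  obtain ⟨p, hpfix⟩ := exists_isFixedPt_pi_stdSimplex (f := fun p i => nashMap (F p i) (p i)) (by
    refine continuous_pi fun i => Continuous.subtype_mk (continuous_pi fun a =>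
      ((hp i a).add (hgain i a)).div
        (continuous_const.add (continuous_finsetSum _ fun b _ => hgain i b)) fun p => ?_) _
    exact (add_pos_of_pos_of_nonneg one_pos
      (Finset.sum_nonneg fun b _ => le_max_right _ _)).ne')
  exact ⟨p, fun i b => sum_mul_le_of_nashMap_eq (congrFun hpfix i) b⟩

namespace SynchronousMFG

variable {E A : Type*} [Fintype E] [Fintype A]

/-! ### Backward induction -/

/-- The least expected discounted cost over the `k` stages that start at time `t`, for a player in
state `i`, when the population distributions are `m`; it is given by backward induction. -/
noncomputable def minCost [Nonempty A] (G : SynchronousMFG E A) (m : ℕ → stdSimplex ℝ E) :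
    ℕ → ℕ → E → ℝ
  | 0, _, _ => 0
  | k + 1, t, i => Finset.univ.inf' Finset.univ_nonempty fun a =>
      G.c i a (m t) + G.δ * ∑ j, G.P i j a (m t) * G.minCost m k (t + 1) j

/-- The cost of playing `a` in state `i` at time `t` and then optimally during `k` stages. -/
noncomputable def actionCost [Nonempty A] (G : SynchronousMFG E A) (m : ℕ → stdSimplex ℝ E)
    (k t : ℕ) (i : E) (a : A) : ℝ :=
  G.c i a (m t) + G.δ * ∑ j, G.P i j a (m t) * G.minCost m k (t + 1) j

theorem minCost_succ_le [Nonempty A] (G : SynchronousMFG E A) (m : ℕ → stdSimplex ℝ E) (k t : ℕ)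
    (i : E) (a : A) : G.minCost m (k + 1) t i ≤ G.actionCost m k t i a :=
  Finset.inf'_le (f := fun a => G.actionCost m k t i a) (Finset.mem_univ a)

theorem le_minCost_succ [Nonempty A] (G : SynchronousMFG E A) {m : ℕ → stdSimplex ℝ E} {k t : ℕ}
    {i : E} {r : ℝ} (h : ∀ a, r ≤ G.actionCost m k t i a) : r ≤ G.minCost m (k + 1) t i :=
  Finset.le_inf' (f := fun a => G.actionCost m k t i a) Finset.univ_nonempty fun a _ => h a

/-- The discounted cost of Player 0 over the `k` stages that start at time `t`. -/
def horizonCost (G : SynchronousMFG E A) (π₀ π : Strategy E A) (k t : ℕ) : ℝ :=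
  ∑ s ∈ Finset.range k, G.δ ^ s * G.stageCost π₀ π (t + s)

theorem horizonCost_succ (G : SynchronousMFG E A) (π₀ π : Strategy E A) (k t : ℕ) :
    G.horizonCost π₀ π (k + 1) t =
      G.stageCost π₀ π t + G.δ * G.horizonCost π₀ π k (t + 1) := by
  rw [horizonCost, Finset.sum_range_succ', add_comm, horizonCost, Finset.mul_sum]
  simp only [pow_zero, one_mul, add_zero]
  congr 1
  refine Finset.sum_congr rfl fun s _ => ?_
  rw [pow_succ', mul_assoc, add_assoc, add_comm 1 s]

/-- The expected cost of the current action is the current stage cost plus the discounted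
minimal cost from the next distribution onwards. -/
theorem sum_mul_actionCost [Nonempty A] (G : SynchronousMFG E A) (π₀ π : Strategy E A) (k t : ℕ) :
    ∑ i, (G.playerDist π₀ π t).1 i *
        ∑ a, (π₀ i t).1 a * G.actionCost (G.popDist π) k t i a =
      G.stageCost π₀ π t +
        G.δ * ∑ j, (G.playerDist π₀ π (t + 1)).1 j * G.minCost (G.popDist π) k (t + 1) j := by
  have hnext : ∀ j, (G.playerDist π₀ π (t + 1)).1 j =
      ∑ i, ∑ a, (G.playerDist π₀ π t).1 i * G.P i j a (G.popDist π t) * (π₀ i t).1 a :=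
    fun j => rfl
  have hswap : ∑ j, (G.playerDist π₀ π (t + 1)).1 j * G.minCost (G.popDist π) k (t + 1) j =
      ∑ i, ∑ a, ∑ j, (G.playerDist π₀ π t).1 i * G.P i j a (G.popDist π t) * (π₀ i t).1 a *
        G.minCost (G.popDist π) k (t + 1) j := by
    simp only [hnext, Finset.sum_mul]
    rw [Finset.sum_comm]
    exact Finset.sum_congr rfl fun i _ => Finset.sum_comm
  rw [hswap, stageCost, Finset.mul_sum, ← Finset.sum_add_distrib]
  refine Finset.sum_congr rfl fun i _ => ?_
  rw [Finset.mul_sum, Finset.mul_sum, ← Finset.sum_add_distrib]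
  refine Finset.sum_congr rfl fun a _ => ?_
  rw [actionCost, mul_add, mul_add, Finset.mul_sum, Finset.mul_sum, Finset.mul_sum, Finset.mul_sum]
  congr 1
  · ring
  · exact Finset.sum_congr rfl fun j _ => by ring

theorem sum_mul_minCost_le_horizonCost [Nonempty A] (G : SynchronousMFG E A)
    (π₀ π : Strategy E A) (k t : ℕ) :
    ∑ i, (G.playerDist π₀ π t).1 i * G.minCost (G.popDist π) k t i ≤ G.horizonCost π₀ π k t := by
  induction k generalizing t with
  | zero => simp [minCost, horizonCost]
  | succ k ih =>
    rw [horizonCost_succ]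
    refine le_trans ?_ (add_le_add_right (mul_le_mul_of_nonneg_left (ih (t + 1)) G.δ_pos.le) _)
    rw [← sum_mul_actionCost]
    refine Finset.sum_le_sum fun i _ => mul_le_mul_of_nonneg_left ?_ ((G.playerDist π₀ π t).2.1 i)
    calc G.minCost (G.popDist π) (k + 1) t i
        = ∑ a, (π₀ i t).1 a * G.minCost (G.popDist π) (k + 1) t i := by
          rw [← Finset.sum_mul, (π₀ i t).2.2, one_mul]
      _ ≤ ∑ a, (π₀ i t).1 a * G.actionCost (G.popDist π) k t i a :=
          Finset.sum_le_sum fun a _ =>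
            mul_le_mul_of_nonneg_left (G.minCost_succ_le _ k t i a) ((π₀ i t).2.1 a)

/-- A strategy that always puts its weight on actions of minimal cost attains the lower bound
`sum_mul_minCost_le_horizonCost`. -/
theorem horizonCost_le_sum_mul_minCost [Nonempty A] (G : SynchronousMFG E A)
    {π₀ π : Strategy E A} {T : ℕ}
    (h : ∀ k t, t + (k + 1) = T → ∀ i b,
      ∑ a, (π₀ i t).1 a * G.actionCost (G.popDist π) k t i a ≤ G.actionCost (G.popDist π) k t i b)
    (k t : ℕ) (hT : t + k = T) :
    G.horizonCost π₀ π k t ≤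
      ∑ i, (G.playerDist π₀ π t).1 i * G.minCost (G.popDist π) k t i := by
  induction k generalizing t with
  | zero => simp [minCost, horizonCost]
  | succ k ih =>
    rw [horizonCost_succ]
    refine le_trans (add_le_add_right
      (mul_le_mul_of_nonneg_left (ih (t + 1) (by omega)) G.δ_pos.le) _) ?_
    rw [← sum_mul_actionCost]
    exact Finset.sum_le_sum fun i _ => mul_le_mul_of_nonneg_left
      (G.le_minCost_succ (h k t hT i)) ((G.playerDist π₀ π t).2.1 i)

/-! ### Continuity in the strategies -/

theorem AssumptionA1.continuous_P {G : SynchronousMFG E A} (hG : G.AssumptionA1) (i j : E) (a : A) :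
    Continuous (G.P i j a) :=
  let ⟨_, hL⟩ := hG.1
  (hL i j a).continuous

section Continuity

variable {X : Type*} [TopologicalSpace X] {G : SynchronousMFG E A}

theorem AssumptionA1.continuous_step (hG : G.AssumptionA1) {m x : X → stdSimplex ℝ E}
    {p : X → E → stdSimplex ℝ A} (hm : Continuous m) (hx : Continuous x) (hp : Continuous p) :
    Continuous fun y => G.step (m y) (x y) (p y) := by
  refine Continuous.subtype_mk (continuous_pi fun j => continuous_finsetSum _ fun i _ =>
    continuous_finsetSum _ fun a _ => ?_) _
  exact (((continuous_apply i).comp (continuous_subtype_val.comp hx)).mul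
    ((hG.continuous_P i j a).comp hm)).mul
      ((continuous_apply a).comp (continuous_subtype_val.comp ((continuous_apply i).comp hp)))

theorem AssumptionA1.continuous_popDist (hG : G.AssumptionA1) {π : X → Strategy E A}
    (hπ : Continuous π) (t : ℕ) : Continuous fun y => G.popDist (π y) t := by
  induction t with
  | zero => exact continuous_const
  | succ t ih => exact hG.continuous_step ih ih (by fun_prop)

theorem AssumptionA1.continuous_playerDist (hG : G.AssumptionA1) {π₀ π : X → Strategy E A}
    (hπ₀ : Continuous π₀) (hπ : Continuous π) (t : ℕ) :
    Continuous fun y => G.playerDist (π₀ y) (π y) t := by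
  induction t with
  | zero => exact continuous_const
  | succ t ih => exact hG.continuous_step (hG.continuous_popDist hπ t) ih (by fun_prop)

theorem AssumptionA1.continuous_stageCost (hG : G.AssumptionA1) {π₀ π : X → Strategy E A}
    (hπ₀ : Continuous π₀) (hπ : Continuous π) (t : ℕ) :
    Continuous fun y => G.stageCost (π₀ y) (π y) t := by
  refine continuous_finsetSum _ fun i _ => continuous_finsetSum _ fun a _ => ?_
  have hp : Continuous fun y => π₀ y i t := by fun_prop
  exact (((continuous_apply i).comp (continuous_subtype_val.comp
    (hG.continuous_playerDist hπ₀ hπ t))).mul ((hG.2 i a).comp (hG.continuous_popDist hπ t))).mul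
      ((continuous_apply a).comp (continuous_subtype_val.comp hp))

variable [Nonempty A]

theorem AssumptionA1.continuous_minCost (hG : G.AssumptionA1) {m : X → ℕ → stdSimplex ℝ E}
    (hm : ∀ t, Continuous fun y => m y t) (k t : ℕ) (i : E) :
    Continuous fun y => G.minCost (m y) k t i := by
  induction k generalizing t i with
  | zero => exact continuous_const
  | succ k ih =>
    refine Continuous.finset_inf'_apply Finset.univ_nonempty fun a _ => ?_
    exact ((hG.2 i a).comp (hm t)).add (continuous_const.mul (continuous_finsetSum _ fun j _ =>
      ((hG.continuous_P i j a).comp (hm t)).mul (ih (t + 1) j)))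

theorem AssumptionA1.continuous_actionCost (hG : G.AssumptionA1) {m : X → ℕ → stdSimplex ℝ E}
    (hm : ∀ t, Continuous fun y => m y t) (k t : ℕ) (i : E) (a : A) :
    Continuous fun y => G.actionCost (m y) k t i a :=
  ((hG.2 i a).comp (hm t)).add (continuous_const.mul (continuous_finsetSum _ fun j _ =>
    ((hG.continuous_P i j a).comp (hm t)).mul (hG.continuous_minCost hm k (t + 1) j)))

end Continuity

/-! ### Equilibria of the truncated game -/

/-- For every horizon `T` the game stopped at time `T` has a mean field equilibrium. -/
theorem exists_horizonCost_le [Nonempty A] (G : SynchronousMFG E A) (hG : G.AssumptionA1) (T : ℕ) :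
    ∃ π : Strategy E A, ∀ σ : Strategy E A, G.horizonCost π π T 0 ≤ G.horizonCost σ π T 0 := by
  -- mixed actions before time `T` determine a strategy, which is constant from time `T` on
  let ext : (E × Fin T → stdSimplex ℝ A) → Strategy E A := fun p i t =>
    if h : t < T then p (i, ⟨t, h⟩) else stdSimplexRetraction 0
  have hext : Continuous ext := by
    refine continuous_pi fun i => continuous_pi fun t => ?_
    by_cases h : t < T
    · simp only [ext, h, dif_pos]; fun_prop
    · simp only [ext, h, dif_neg, not_false_eq_true]; fun_prop
  -- after the stage at time `t < T`, there remain `T - 1 - t` stages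
  obtain ⟨p, hp⟩ := exists_forall_sum_mul_le
    (F := fun p k a => G.actionCost (G.popDist (ext p)) (T - 1 - k.2) k.2 k.1 a)
    (continuous_pi fun k => continuous_pi fun a =>
      hG.continuous_actionCost (fun t => hG.continuous_popDist hext t) _ _ _ _)
  refine ⟨ext p, fun σ => (G.horizonCost_le_sum_mul_minCost (fun k t ht i b => ?_) T 0
    (zero_add T)).trans (G.sum_mul_minCost_le_horizonCost σ (ext p) T 0)⟩
  have htT : t < T := by omega
  have hk : T - 1 - t = k := by omega
  have := hp (i, ⟨t, htT⟩) b
  simp only [hk] at this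
  simpa only [ext, htT, dif_pos] using this

/-! ### Passage to the infinite horizon -/

theorem exists_abs_stageCost_le (G : SynchronousMFG E A) (hG : G.AssumptionA1) :
    ∃ C : ℝ, ∀ (π₀ π : Strategy E A) (t : ℕ), |G.stageCost π₀ π t| ≤ C := by
  have hb : ∀ i a, ∃ C : ℝ, ∀ m, |G.c i a m| ≤ C := fun i a => by
    obtain ⟨C, hC⟩ := isCompact_univ.exists_bound_of_continuousOn (hG.2 i a).continuousOn
    exact ⟨C, fun m => hC m (Set.mem_univ m)⟩
  choose C hC using hb
  refine ⟨∑ i, ∑ a, C i a, fun π₀ π t => ?_⟩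
  refine (Finset.abs_sum_le_sum_abs _ _).trans (Finset.sum_le_sum fun i _ => ?_)
  refine (Finset.abs_sum_le_sum_abs _ _).trans (Finset.sum_le_sum fun a _ => ?_)
  have hx := mem_Icc_of_mem_stdSimplex (G.playerDist π₀ π t).2 i
  have hp := mem_Icc_of_mem_stdSimplex (π₀ i t).2 a
  have h0 := abs_nonneg (G.c i a (G.popDist π t))
  rw [abs_mul, abs_mul, abs_of_nonneg hx.1, abs_of_nonneg hp.1]
  exact (mul_le_of_le_one_right (mul_nonneg hx.1 h0) hp.2).trans
    ((mul_le_of_le_one_left h0 hx.2).trans (hC i a _))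

/-- The costs over the horizons `T` converge to the total discounted cost uniformly in the
strategies. -/
theorem tendstoUniformly_horizonCost (G : SynchronousMFG E A) (hG : G.AssumptionA1) :
    TendstoUniformly (fun T (q : Strategy E A × Strategy E A) => G.horizonCost q.1 q.2 T 0)
      (fun q => ∑' t : ℕ, G.δ ^ t * G.stageCost q.1 q.2 t) Filter.atTop := by
  obtain ⟨C, hC⟩ := G.exists_abs_stageCost_le hG
  have := tendstoUniformly_tsum_nat (u := fun t => G.δ ^ t * C)
    (f := fun t (q : Strategy E A × Strategy E A) => G.δ ^ t * G.stageCost q.1 q.2 t)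
    ((summable_geometric_of_lt_one G.δ_pos.le G.δ_lt_one).mul_right C) fun t q => by
      rw [norm_mul, Real.norm_of_nonneg (pow_nonneg G.δ_pos.le t)]
      exact mul_le_mul_of_nonneg_left (hC q.1 q.2 t) (pow_nonneg G.δ_pos.le t)
  simpa only [horizonCost, zero_add] using this

theorem continuous_tsum_stageCost (G : SynchronousMFG E A) (hG : G.AssumptionA1) :
    Continuous fun q : Strategy E A × Strategy E A =>
      ∑' t : ℕ, G.δ ^ t * G.stageCost q.1 q.2 t := by
  refine (G.tendstoUniformly_horizonCost hG).continuous (Filter.Eventually.frequently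
    (Filter.Eventually.of_forall fun T => continuous_finsetSum _ fun s _ => ?_))
  exact continuous_const.mul (hG.continuous_stageCost continuous_fst continuous_snd _)

end SynchronousMFG

theorem mainTheorem4 {E A : Type*} [Fintype E] [Fintype A] [Nonempty A]
    (G : SynchronousMFG E A) (hG : G.AssumptionA1) :
    ∃ π : SynchronousMFG.Strategy E A, G.IsMeanFieldEquilibrium π := by
  choose π hπ using G.exists_horizonCost_le hG
  -- the strategies form a compact metrizable space; any limit of the `π T` is an equilibrium
  obtain ⟨ρ, φ, hφ, hlim⟩ := CompactSpace.tendsto_subseq π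
  have hunif : TendstoUniformly (fun n (q : SynchronousMFG.Strategy E A ×
      SynchronousMFG.Strategy E A) => G.horizonCost q.1 q.2 (φ n) 0)
      (fun q => ∑' t : ℕ, G.δ ^ t * G.stageCost q.1 q.2 t) Filter.atTop := fun u hu =>
    hφ.tendsto_atTop.eventually (G.tendstoUniformly_horizonCost hG u hu)
  have hc := G.continuous_tsum_stageCost hG
  refine ⟨ρ, fun σ => ?_⟩
  have h1 := hunif.tendsto_comp hc.continuousAt (hlim.prodMk_nhds hlim)
  have h2 := hunif.tendsto_comp hc.continuousAt ((tendsto_const_nhds (x := σ)).prodMk_nhds hlim)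
  exact mul_le_mul_of_nonneg_left (le_of_tendsto_of_tendsto' h1 h2 fun n => hπ (φ n) σ)
    (sub_nonneg.2 G.δ_lt_one.le)
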